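/- Let $L\ge 1$ and let $X\sim\mathcal N(0,\Sigma_X)$ be an $\mathbb R^L$-valued Gaussian source with $\Sigma_X\succ 0$ and eigenvalue decomposition $\Sigma_X=\Theta^T\operatorname{diag}(\lambda_1,\dots,\lambda_L)\Theta$, where $\Theta$ is a real orthogonal matrix. For $D\ge 0$ and $P\in[0,\infty]$ let $$R(D,P)=\inf\{\, I(X;\hat X)\;:\; P_{\hat X|X},\ \mathbb E\|X-\hat X\|^2\le D,\ \phi(P_X,P_{\hat X})\le P\,\}$$ (in nats), where the perception loss $\phi(P_X,P_{\hat X})$ is either the KL divergence $D(P_{\hat X}\|P_X)$ or the squared Wasserstein-2 distance $W_2^2(P_X,P_{\hat X})$; $P=\infty$ means that there is no perception constraint. For $D>0$ let $\nu(D)$ be a solution of $\sum_{\ell=1}^L[\lambda_\ell-\nu(D)]^+=\big[\sum_{\ell=1}^L\lambda_\ell-D\big]^+$, where $[x]^+=\max\{0,x\}$, and define the water levels $\gamma^*_\ell(D,\infty)=\lambda_\ell$ if $\nu(D)\ge\lambda_\ell$ and $\gamma^*_\ell(D,\infty)=\nu(D)$ if $\nu(D)<\lambda_\ell$. Then there is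 $\epsilon_0>0$ (which may depend on the source) such that for every $0<\epsilon<\epsilon_0$ the solution $\nu(\epsilon)$ exists and is unique, $$R(\epsilon,\infty)=\frac12\sum_{\ell=1}^L\log\frac{L\lambda_\ell}{\epsilon},$$ and $$\gamma^*_\ell(\epsilon,\infty)=\frac{\epsilon}{L}\qquad\text{for all }\ell\in\{1,\dots,L\}.$$ -/

import Mathlib

open MeasureTheory ProbabilityTheory
open scoped ENNReal

namespace RDP

/-- A perception loss `φ(P_X, P_X̂)` comparing the source law with the reconstruction law. -/
abbrev PerceptionLoss (E : Type*) [MeasurableSpace E] := Measure E → Measure E → ℝ≥0∞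

/-- The KL perception loss `φ(P, Q) = D(Q ‖ P)` (`P` the source law, `Q` the reconstruction law),
in nats. -/
noncomputable def klLoss (E : Type*) [MeasurableSpace E] : PerceptionLoss E :=
  fun P Q => InformationTheory.klDiv Q P

/-- The squared Wasserstein-2 loss: the infimum of `𝔼‖X - X̂‖²` over all couplings of `P`, `Q`. -/
noncomputable def wassersteinLoss (E : Type*) [NormedAddCommGroup E] [MeasurableSpace E] :
    PerceptionLoss E :=
  fun P Q => ⨅ (π : Measure (E × E)) (_ : π.map Prod.fst = P ∧ π.map Prod.snd = Q),
    ∫⁻ z, ‖z.1 - z.2‖ₑ ^ 2 ∂π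

/-- Mutual information `I(X; X̂)`, in nats, of an input `X ∼ P` and the output `X̂` of the
channel `κ`: the divergence of the joint law from the product of its marginals. -/
noncomputable def mutualInfo {E F : Type*} [MeasurableSpace E] [MeasurableSpace F]
    (P : Measure E) (κ : Kernel E F) : ℝ≥0∞ :=
  InformationTheory.klDiv (P ⊗ₘ κ) (P.prod (κ ∘ₘ P))

/-- Expected squared-error distortion `𝔼‖X - X̂‖²` for `X ∼ P` and channel `κ`. -/
noncomputable def distortion {E : Type*} [NormedAddCommGroup E] [MeasurableSpace E]
    (P : Measure E) (κ : Kernel E E) : ℝ≥0∞ :=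
  ∫⁻ z, ‖z.1 - z.2‖ₑ ^ 2 ∂(P ⊗ₘ κ)

/-- The conditional distributions `P_{X̂|X}` that meet the distortion constraint `D` and the
perception constraint `p`; the value `p = ∞` imposes no perception constraint. -/
def admissible {E : Type*} [NormedAddCommGroup E] [MeasurableSpace E]
    (φ : PerceptionLoss E) (P : Measure E) (D p : ℝ≥0∞) : Set (Kernel E E) :=
  {κ | IsMarkovKernel κ ∧ distortion P κ ≤ D ∧ φ P (κ ∘ₘ P) ≤ p}

/-- The information rate-distortion-perception function `R(D, p)` of the source law `P`. -/
noncomputable def rdpFunction {E : Type*} [NormedAddCommGroup E] [MeasurableSpace E]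
    (φ : PerceptionLoss E) (P : Measure E) (D p : ℝ≥0∞) : ℝ≥0∞ :=
  ⨅ κ ∈ admissible φ P D p, mutualInfo P κ

/-- `ν` solves the reverse water-filling equation `∑ [λ_ℓ - ν]⁺ = [∑ λ_ℓ - D]⁺`. -/
def IsWaterFillingLevel {L : ℕ} (lam : Fin L → ℝ) (D ν : ℝ) : Prop :=
  ∑ l, max 0 (lam l - ν) = max 0 (∑ l, lam l - D)

/-- The water level `γ_ℓ` of component `ℓ` for the reverse water-filling constant `ν`:
`λ_ℓ` if `ν ≥ λ_ℓ`, and `ν` if `ν < λ_ℓ`. -/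
noncomputable def waterLevel {L : ℕ} (lam : Fin L → ℝ) (ν : ℝ) (l : Fin L) : ℝ :=
  if lam l ≤ ν then lam l else ν

end RDP

/-! ### Densities and second moments of Gaussian laws -/

section GaussianDensity

variable {ι : Type*} [Fintype ι]

/-! Put `c = ε / L` and take `ε` so small that `c` lies below every eigenvalue. Let `exp (-h)` and
`exp (-g)` be the densities of `N(0, S)` and `N(0, c I)`. For any channel with output law `Q`, the
function `exp (h x - g (x - y))` has integral 1 against the product of the marginals, by translation
invariance. Donsker–Varadhan then gives `I ≥ 𝔼 h(X) - 𝔼 g(X - X̂)`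
(`ofReal_integral_le_mutualInfo`), and since `g` is a constant plus `‖·‖² / (2c)`, the distortion
constraint bounds the last term. This is the Shannon lower bound.

It is attained by the backward channel `X = X̂ + N` with independent `N ∼ N(0, c I)` and `X̂ ∼ N(0,
S - c I)`, which exists because `S - c I` is positive semidefinite: its joint law is exactly the
tilted product, so Donsker–Varadhan is an equality (`exists_kernel_mutualInfo_eq`). At `p = ∞` the
perception loss plays no role. -/

theorem stdGaussian_eq_withDensity :
    stdGaussian (EuclideanSpace ℝ ι) = volume.withDensity fun x ↦
      ENNReal.ofReal (Real.exp (-(Fintype.card ι / 2 * Real.log (2 * Real.pi) + ‖x‖ ^ 2 / 2))) := by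
  set c : ℝ := Real.exp (-(Fintype.card ι / 2 * Real.log (2 * Real.pi))) with hc
  have hf (x : EuclideanSpace ℝ ι) :
      Real.exp (-(Fintype.card ι / 2 * Real.log (2 * Real.pi) + ‖x‖ ^ 2 / 2)) =
        c * Real.exp (-(1 / 2) * ‖x‖ ^ 2) := by
    rw [hc, ← Real.exp_add]; congr 1; ring
  have hb : 0 < (1 / 2 : ℂ).re := by norm_num
  have hint : Integrable (fun x : EuclideanSpace ℝ ι ↦ c * Real.exp (-(1 / 2) * ‖x‖ ^ 2)) := by
    have := (GaussianFourier.integrable_cexp_neg_mul_sq_norm_add hb 0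
      (0 : EuclideanSpace ℝ ι)).re.const_mul c
    refine this.congr (.of_forall fun x ↦ ?_)
    simp only [zero_mul, add_zero]
    congr 1
    have : (-(1 / 2 : ℂ) * (‖x‖ : ℂ) ^ 2) = ((-(1 / 2) * ‖x‖ ^ 2 : ℝ) : ℂ) := by push_cast; ring
    rw [this]
    exact Complex.exp_ofReal_re _
  have hcc : (c : ℂ) * (Real.pi / (1 / 2 : ℂ)) ^ (Fintype.card ι / 2 : ℂ) = 1 := by
    have h2 : (Real.pi / (1 / 2 : ℂ)) = ((2 * Real.pi : ℝ) : ℂ) := by push_cast; ring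
    have h3 : (Fintype.card ι / 2 : ℂ) = ((Fintype.card ι / 2 : ℝ) : ℂ) := by push_cast; ring
    rw [h2, h3, ← Complex.ofReal_cpow (by positivity), ← Complex.ofReal_mul, hc,
      Real.rpow_def_of_pos (by positivity), ← Real.exp_add]
    norm_num
    ring_nf
    simp
  simp_rw [hf]
  have := isFiniteMeasure_withDensity_ofReal (μ := (volume : Measure (EuclideanSpace ℝ ι))) hint.2
  refine Measure.ext_of_charFun (funext fun t ↦ ?_)
  rw [charFun_stdGaussian, charFun_apply, integral_withDensity_eq_integral_toReal_smul
    (by fun_prop) (.of_forall fun x ↦ ENNReal.ofReal_lt_top)]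
  have hpt (x : EuclideanSpace ℝ ι) :
      (ENNReal.ofReal (c * Real.exp (-(1 / 2) * ‖x‖ ^ 2))).toReal •
        Complex.exp (inner ℝ x t * Complex.I) =
      c * Complex.exp (-(1 / 2 : ℂ) * ‖x‖ ^ 2 + Complex.I * inner ℝ t x) := by
    rw [ENNReal.toReal_ofReal (by positivity), Complex.real_smul, Complex.exp_add,
      real_inner_comm x t, mul_comm Complex.I]
    push_cast
    ring
  simp_rw [hpt]
  rw [integral_const_mul, GaussianFourier.integral_cexp_neg_mul_sq_norm_add hb, finrank_euclideanSpace,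
    ← mul_assoc, hcc, one_mul]
  congr 1
  rw [Complex.I_sq]
  ring

/-- Linear change of variables for densities; it carries the standard Gaussian density to a general
covariance. -/
theorem withDensity_map_addHaar {E : Type*} [NormedAddCommGroup E] [NormedSpace ℝ E]
    [FiniteDimensional ℝ E] [MeasurableSpace E] [BorelSpace E] (μ : Measure E) [μ.IsAddHaarMeasure]
    (T S : E →L[ℝ] E) (hST : ∀ x, S (T x) = x) (hdet : LinearMap.det (T : E →ₗ[ℝ] E) ≠ 0)
    {f : E → ℝ≥0∞} (hf : Measurable f) :
    (μ.withDensity f).map T = μ.withDensity fun x ↦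
      ENNReal.ofReal |(LinearMap.det (T : E →ₗ[ℝ] E))⁻¹| * f (S x) := by
  have hT : Measurable T := T.continuous.measurable
  have hS : Measurable S := S.continuous.measurable
  refine Measure.ext_of_lintegral _ fun g hg ↦ ?_
  rw [lintegral_map hg hT, lintegral_withDensity_eq_lintegral_mul _ hf (g := fun a ↦ g (T a)) (hg.comp hT),
    lintegral_withDensity_eq_lintegral_mul _
      (f := fun x ↦ ENNReal.ofReal |(LinearMap.det (T : E →ₗ[ℝ] E))⁻¹| * f (S x)) (by fun_prop) hg]
  have hk : Measurable fun x ↦ f (S x) * g x := by fun_prop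
  simp only [Pi.mul_apply, mul_assoc]
  rw [lintegral_const_mul _ hk, ← smul_eq_mul, ← lintegral_smul_measure,
    ← Measure.map_linearMap_addHaar_eq_smul_addHaar μ hdet, lintegral_map hk (by exact hT)]
  simp [hST]

variable [DecidableEq ι]

open scoped MatrixOrder in
theorem Matrix.PosDef.isUnit_det_sqrt_and_sqrt_mul_inv_mul_sqrt {S : Matrix ι ι ℝ} (hS : S.PosDef) :
    IsUnit (CFC.sqrt S).det ∧ CFC.sqrt S * S⁻¹ * CFC.sqrt S = 1 ∧
      |(CFC.sqrt S).det| = √S.det := by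
  have h : CFC.sqrt S * CFC.sqrt S = S := CFC.sqrt_mul_sqrt_self S hS.posSemidef.nonneg
  have hd : (CFC.sqrt S).det * (CFC.sqrt S).det = S.det := by rw [← Matrix.det_mul, h]
  have hpos := hS.det_pos
  have hu : IsUnit (CFC.sqrt S).det := by
    rw [isUnit_iff_ne_zero]
    intro h0
    rw [h0, mul_zero] at hd
    exact hpos.ne hd
  refine ⟨hu, ?_, ?_⟩
  · nth_rewrite 2 [← h]
    rw [Matrix.mul_inv_rev, ← mul_assoc, Matrix.mul_nonsing_inv _ hu, one_mul,
      Matrix.nonsing_inv_mul _ hu]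
  · rw [← hd, Real.sqrt_mul_self_eq_abs]

open scoped MatrixOrder in
theorem Matrix.dotProduct_sqrt_mulVec_inv {S : Matrix ι ι ℝ} (hS : S.PosDef) (x : ι → ℝ) :
    (CFC.sqrt S).mulVec x ⬝ᵥ S⁻¹.mulVec ((CFC.sqrt S).mulVec x) = x ⬝ᵥ x := by
  have hT : (CFC.sqrt S).transpose = CFC.sqrt S := by
    have := (CFC.sqrt_nonneg S).isSelfAdjoint
    simpa [IsSelfAdjoint, Matrix.star_eq_conjTranspose] using this
  rw [Matrix.mulVec_mulVec, ← Matrix.vecMul_transpose, hT, ← Matrix.dotProduct_mulVec,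
    Matrix.mulVec_mulVec, ← mul_assoc, (Matrix.PosDef.isUnit_det_sqrt_and_sqrt_mul_inv_mul_sqrt hS).2.1,
    Matrix.one_mulVec]

/-- Minus the logarithm of the density of the centred Gaussian law with covariance `S`. -/
noncomputable def gaussianPotential (S : Matrix ι ι ℝ) (x : EuclideanSpace ℝ ι) : ℝ :=
  Fintype.card ι / 2 * Real.log (2 * Real.pi) + Real.log S.det / 2 + x ⬝ᵥ S⁻¹.mulVec x / 2

theorem continuous_gaussianPotential (S : Matrix ι ι ℝ) : Continuous (gaussianPotential S) := by
  unfold gaussianPotential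
  have : Continuous fun x : EuclideanSpace ℝ ι ↦ x.ofLp := PiLp.continuous_ofLp 2 _
  have h2 : Continuous fun x : EuclideanSpace ℝ ι ↦ S⁻¹.mulVec x.ofLp :=
    Continuous.matrix_mulVec continuous_const this
  have h3 := this.dotProduct h2
  fun_prop

open scoped MatrixOrder in
theorem multivariateGaussian_zero_eq_withDensity {S : Matrix ι ι ℝ} (hS : S.PosDef) :
    multivariateGaussian 0 S =
      volume.withDensity fun x ↦ ENNReal.ofReal (Real.exp (-gaussianPotential S x)) := by
  obtain ⟨hu, h1, hdet⟩ := hS.isUnit_det_sqrt_and_sqrt_mul_inv_mul_sqrt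
  set R := CFC.sqrt S with hR
  have hdetT : LinearMap.det (Matrix.toEuclideanCLM (𝕜 := ℝ) R :
      EuclideanSpace ℝ ι →ₗ[ℝ] EuclideanSpace ℝ ι) = R.det := by
    rw [Matrix.coe_toEuclideanCLM_eq_toEuclideanLin]
    exact (congrArg _ (congrArg (· R) (Matrix.toLpLin_eq_toLin 2 2))).trans (LinearMap.det_toLin _ _)
  rw [multivariateGaussian, stdGaussian_eq_withDensity]
  simp only [zero_add]
  rw [withDensity_map_addHaar volume (Matrix.toEuclideanCLM (𝕜 := ℝ) R)
    (Matrix.toEuclideanCLM (𝕜 := ℝ) R⁻¹) (fun x ↦ ?_) (by rw [hdetT]; exact hu.ne_zero)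
    (by fun_prop), hdetT]
  · congr with x
    rw [← ENNReal.ofReal_mul (by positivity), abs_inv, hdet, gaussianPotential]
    congr 1
    have hsq : (√S.det)⁻¹ = Real.exp (-(Real.log S.det / 2)) := by
      rw [Real.exp_neg, ← Real.log_sqrt hS.det_pos.le,
        Real.exp_log (Real.sqrt_pos.2 hS.det_pos)]
    have hx : ‖Matrix.toEuclideanCLM (𝕜 := ℝ) R⁻¹ x‖ ^ 2 = x ⬝ᵥ S⁻¹.mulVec x := by
      rw [EuclideanSpace.real_norm_sq_eq, Matrix.ofLp_toEuclideanCLM]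
      have := Matrix.dotProduct_sqrt_mulVec_inv hS (R⁻¹.mulVec x)
      rw [← hR, Matrix.mulVec_mulVec, Matrix.mul_nonsing_inv _ hu, Matrix.one_mulVec] at this
      rw [this]
      simp [dotProduct, sq]
    rw [hsq, ← Real.exp_add, hx]
    congr 1
    ring
  · rw [← ContinuousLinearMap.comp_apply, ← ContinuousLinearMap.mul_def, ← map_mul,
      Matrix.nonsing_inv_mul _ hu, map_one, one_apply_eq_self]

theorem lintegral_enorm_sq_multivariateGaussian {S : Matrix ι ι ℝ} (hS : S.PosSemidef) :
    ∫⁻ x, ‖x‖ₑ ^ 2 ∂multivariateGaussian 0 S = ENNReal.ofReal S.trace := by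
  have hmem := IsGaussian.memLp_two_id (μ := multivariateGaussian 0 S)
  have hint (i : ι) : Integrable (fun x : EuclideanSpace ℝ ι ↦ x i ^ 2) (multivariateGaussian 0 S) :=
    ((EuclideanSpace.proj (𝕜 := ℝ) i).comp_memLp' hmem).integrable_sq
  have hval (i : ι) : ∫ x, x i ^ 2 ∂multivariateGaussian 0 S = S i i := by
    rw [← variance_eval_multivariateGaussian (μ := 0) hS i, variance_of_integral_eq_zero]
    · fun_prop
    · have := ContinuousLinearMap.integral_comp_id_comm (IsGaussian.integrable_id (μ := multivariateGaussian 0 S))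
        (EuclideanSpace.proj (𝕜 := ℝ) i)
      simpa using this
  have h2 (x : EuclideanSpace ℝ ι) : ‖x‖ₑ ^ 2 = ENNReal.ofReal (∑ i, x i ^ 2) := by
    rw [← EuclideanSpace.real_norm_sq_eq, ENNReal.ofReal_pow (norm_nonneg _), ofReal_norm]
  simp_rw [h2]
  rw [← ofReal_integral_eq_lintegral_ofReal (integrable_finsetSum _ fun i _ ↦ hint i)
    (.of_forall fun x ↦ Finset.sum_nonneg fun i _ ↦ sq_nonneg _),
    integral_finsetSum _ fun i _ ↦ hint i]
  simp [hval, Matrix.trace]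

open scoped MatrixOrder in
-- This is the differential entropy of `N(0, S)`. Pulled back along `CFC.sqrt S`, the quadratic form
-- becomes `‖x‖² / 2`, with standard Gaussian mean half the dimension.
theorem integral_gaussianPotential {S : Matrix ι ι ℝ} (hS : S.PosDef) :
    Integrable (gaussianPotential S) (multivariateGaussian 0 S) ∧
    ∫ x, gaussianPotential S x ∂multivariateGaussian 0 S =
      Fintype.card ι / 2 * Real.log (2 * Real.pi) + Real.log S.det / 2 + Fintype.card ι / 2 := by
  have hcomp (x : EuclideanSpace ℝ ι) :
      gaussianPotential S (0 + Matrix.toEuclideanCLM (𝕜 := ℝ) (CFC.sqrt S) x) =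
      Fintype.card ι / 2 * Real.log (2 * Real.pi) + Real.log S.det / 2 + ‖x‖ ^ 2 / 2 := by
    rw [zero_add, gaussianPotential, Matrix.ofLp_toEuclideanCLM,
      Matrix.dotProduct_sqrt_mulVec_inv hS, EuclideanSpace.real_norm_sq_eq]
    simp [dotProduct, sq]
  have hmeas : AEMeasurable (fun x ↦ 0 + Matrix.toEuclideanCLM (𝕜 := ℝ) (CFC.sqrt S) x)
      (stdGaussian (EuclideanSpace ℝ ι)) := by fun_prop
  have hsm := (continuous_gaussianPotential S).aestronglyMeasurable
    (μ := (stdGaussian (EuclideanSpace ℝ ι)).map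
      fun x ↦ 0 + Matrix.toEuclideanCLM (𝕜 := ℝ) (CFC.sqrt S) x)
  have hsq : Integrable (fun x ↦ ‖x‖ ^ 2) (stdGaussian (EuclideanSpace ℝ ι)) :=
    IsGaussian.memLp_two_id.integrable_norm_pow (by norm_num)
  have hval : ∫ x, ‖x‖ ^ 2 ∂stdGaussian (EuclideanSpace ℝ ι) = Fintype.card ι := by
    have h := lintegral_enorm_sq_multivariateGaussian (S := (1 : Matrix ι ι ℝ)) Matrix.PosSemidef.one
    rw [multivariateGaussian_zero_one, Matrix.trace_one] at h
    rw [integral_eq_lintegral_of_nonneg_ae (.of_forall fun x ↦ by positivity) hsq.1]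
    simp_rw [ENNReal.ofReal_pow (norm_nonneg _), ofReal_norm]
    rw [h, ENNReal.toReal_ofReal (by positivity)]
  constructor
  · rw [multivariateGaussian, integrable_map_measure hsm hmeas]
    refine Integrable.congr ?_ (.of_forall fun x ↦ (hcomp x).symm)
    exact (integrable_const _).add (hsq.div_const 2)
  · rw [multivariateGaussian, integral_map hmeas hsm]
    simp_rw [hcomp]
    rw [integral_add (integrable_const _) (hsq.div_const 2), integral_div, hval]
    simp

end GaussianDensity

/-! ### Donsker–Varadhan inequality and its equality case -/

section Gibbs

variable {α : Type*} [MeasurableSpace α]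

/-- Donsker–Varadhan bound for a normalized exponential density. -/
theorem ofReal_integral_le_klDiv (μ ν : Measure α) [IsProbabilityMeasure μ]
    [IsProbabilityMeasure ν] {f : α → ℝ} (hf : Integrable (fun x ↦ Real.exp (f x)) ν)
    (h1 : ∫ x, Real.exp (f x) ∂ν = 1) (hfμ : Integrable f μ) :
    ENNReal.ofReal (∫ x, f x ∂μ) ≤ InformationTheory.klDiv μ ν := by
  by_cases h : InformationTheory.klDiv μ ν = ∞
  · simp [h]
  obtain ⟨hac, hint⟩ := InformationTheory.klDiv_ne_top_iff.1 h
  have := isProbabilityMeasure_tilted hf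
  -- The divergence of `μ` from `ν.tilted f` is nonnegative and equals `klDiv μ ν` minus `∫ f ∂μ`,
  -- as the normalizing constant is 1.
  have h0 := InformationTheory.integral_llr_add_sub_measure_univ_nonneg
    (hac.trans (absolutelyContinuous_tilted hf)) (integrable_llr_tilted_right hac hfμ hint hf)
  rw [integral_llr_tilted_right hac hfμ hf hint, h1] at h0
  rw [InformationTheory.klDiv_of_ac_of_integrable hac hint]
  refine ENNReal.ofReal_le_ofReal ?_
  simp only [probReal_univ, Real.log_one] at h0 ⊢
  linarith

/-- Equality case: the log-likelihood ratio of the tilted measure is `f` itself. -/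
theorem klDiv_tilted_left_self (ν : Measure α) [IsProbabilityMeasure ν] {f : α → ℝ}
    (hf : Integrable (fun x ↦ Real.exp (f x)) ν) (h1 : ∫ x, Real.exp (f x) ∂ν = 1)
    (hfμ : Integrable f (ν.tilted f)) :
    InformationTheory.klDiv (ν.tilted f) ν = ENNReal.ofReal (∫ x, f x ∂ν.tilted f) := by
  have := isProbabilityMeasure_tilted hf
  have hac := tilted_absolutelyContinuous ν f
  have hllr : llr (ν.tilted f) ν =ᵐ[ν.tilted f] f := by
    filter_upwards [hac.ae_le (log_rnDeriv_tilted_left_self hf)] with x hx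
    rw [llr, hx, h1, Real.log_one, sub_zero]
  rw [InformationTheory.klDiv_of_ac_of_integrable hac (hfμ.congr hllr.symm),
    integral_congr_ae hllr]
  simp

end Gibbs

/-! ### Shannon lower bound and the backward channel -/

section ShannonLowerBound

variable {E : Type*} [NormedAddCommGroup E] [MeasurableSpace E] [BorelSpace E]
  [SecondCountableTopology E] {vol : Measure E} [vol.IsAddRightInvariant]

/-- On the fibre over `y` the factor `exp (h x)` cancels the density of `P`; translating by `y`
leaves the density of `N`. Only `P` and `N` need densities, so `Q` may be singular. -/
theorem withDensity_prod_sub_eq_map {g h : E → ℝ} (hg : Measurable g) (hh : Measurable h)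
    {P N Q : Measure E} [SFinite P] [SFinite Q] [SFinite N]
    (hP : P = vol.withDensity fun x ↦ ENNReal.ofReal (Real.exp (-h x)))
    (hN : N = vol.withDensity fun x ↦ ENNReal.ofReal (Real.exp (-g x))) :
    (P.prod Q).withDensity (fun z ↦ ENNReal.ofReal (Real.exp (h z.1 - g (z.1 - z.2)))) =
      (N.prod Q).map fun z ↦ (z.1 + z.2, z.2) := by
  refine Measure.ext_of_lintegral _ fun k hk ↦ ?_
  have hk' : Measurable fun z : E × E ↦ k (z.1 + z.2, z.2) := hk.comp (by fun_prop)
  rw [lintegral_withDensity_eq_lintegral_mul _ (by fun_prop) hk, lintegral_map hk (by fun_prop),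
    lintegral_prod_symm _ (by fun_prop), lintegral_prod_symm _ hk'.aemeasurable]
  refine lintegral_congr fun y ↦ ?_
  rw [hP, hN, lintegral_withDensity_eq_lintegral_mul _ (by fun_prop) (by fun_prop),
    lintegral_withDensity_eq_lintegral_mul _ (by fun_prop) (by fun_prop),
    ← lintegral_add_right_eq_self _ y]
  refine lintegral_congr fun x ↦ ?_
  simp only [Pi.mul_apply, add_sub_cancel_right]
  rw [← mul_assoc, ← ENNReal.ofReal_mul (by positivity), ← Real.exp_add]
  congr 3
  ring

theorem prod_tilted_sub_eq_map {g h : E → ℝ} (hg : Measurable g) (hh : Measurable h)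
    {P N Q : Measure E} [IsProbabilityMeasure P] [IsProbabilityMeasure Q] [IsProbabilityMeasure N]
    (hP : P = vol.withDensity fun x ↦ ENNReal.ofReal (Real.exp (-h x)))
    (hN : N = vol.withDensity fun x ↦ ENNReal.ofReal (Real.exp (-g x))) :
    Integrable (fun z : E × E ↦ Real.exp (h z.1 - g (z.1 - z.2))) (P.prod Q) ∧
    ∫ z, Real.exp (h z.1 - g (z.1 - z.2)) ∂P.prod Q = 1 ∧
    (P.prod Q).tilted (fun z ↦ h z.1 - g (z.1 - z.2)) =
      (N.prod Q).map fun z ↦ (z.1 + z.2, z.2) := by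
  have h1 := withDensity_prod_sub_eq_map (Q := Q) hg hh hP hN
  have hprob : IsProbabilityMeasure ((N.prod Q).map fun z ↦ (z.1 + z.2, z.2)) :=
    Measure.isProbabilityMeasure_map (by fun_prop)
  have hl : ∫⁻ z, ENNReal.ofReal (Real.exp (h z.1 - g (z.1 - z.2))) ∂P.prod Q = 1 := by
    rw [← setLIntegral_univ, ← withDensity_apply _ .univ, h1]
    exact measure_univ
  have hm : AEStronglyMeasurable (fun z : E × E ↦ Real.exp (h z.1 - g (z.1 - z.2)))
      (P.prod Q) := Measurable.aestronglyMeasurable (by fun_prop)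
  have hint : ∫ z, Real.exp (h z.1 - g (z.1 - z.2)) ∂P.prod Q = 1 := by
    rw [integral_eq_lintegral_of_nonneg_ae (.of_forall fun _ ↦ (Real.exp_pos _).le) hm, hl]
    rfl
  refine ⟨?_, hint, ?_⟩
  -- A non-integrable function has integral 0 by convention, which contradicts the value 1.
  · by_contra hn
    rw [integral_undef hn] at hint
    exact zero_ne_one hint
  · rw [Measure.tilted, hint]
    simpa using h1

theorem ofReal_integral_le_mutualInfo {g h : E → ℝ} (hg : Measurable g) (hh : Measurable h)
    {P N : Measure E} [IsProbabilityMeasure P] [IsProbabilityMeasure N]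
    (hP : P = vol.withDensity fun x ↦ ENNReal.ofReal (Real.exp (-h x)))
    (hN : N = vol.withDensity fun x ↦ ENNReal.ofReal (Real.exp (-g x)))
    (hhi : Integrable h P) (κ : Kernel E E) [IsMarkovKernel κ]
    (hgi : Integrable (fun z : E × E ↦ g (z.1 - z.2)) (P ⊗ₘ κ)) :
    ENNReal.ofReal (∫ x, h x ∂P - ∫ z, g (z.1 - z.2) ∂(P ⊗ₘ κ)) ≤ RDP.mutualInfo P κ := by
  obtain ⟨h1, h2, -⟩ := prod_tilted_sub_eq_map (Q := κ ∘ₘ P) hg hh hP hN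
  have hfst : Integrable (fun z : E × E ↦ h z.1) (P ⊗ₘ κ) := by
    rw [← Measure.fst_compProd P κ] at hhi
    exact hhi.comp_measurable measurable_fst
  have hfi : ∫ z, h z.1 ∂(P ⊗ₘ κ) = ∫ x, h x ∂P := by
    conv_rhs => rw [← Measure.fst_compProd P κ]
    rw [Measure.fst, integral_map (by fun_prop) hh.aestronglyMeasurable]
  rw [← hfi, ← integral_sub hfst hgi]
  exact ofReal_integral_le_klDiv _ _ h1 h2 (hfst.sub hgi)

/-- The joint law of `(N + X̂, X̂)` has first marginal `P` because `N ∗ Q = P`; disintegrating it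
over that marginal gives the forward channel. -/
theorem exists_kernel_mutualInfo_eq [StandardBorelSpace E] [Nonempty E]
    {g h : E → ℝ} (hg : Measurable g) (hh : Measurable h)
    {P N Q : Measure E} [IsProbabilityMeasure P] [IsProbabilityMeasure Q] [IsProbabilityMeasure N]
    (hP : P = vol.withDensity fun x ↦ ENNReal.ofReal (Real.exp (-h x)))
    (hN : N = vol.withDensity fun x ↦ ENNReal.ofReal (Real.exp (-g x)))
    (hPN : N ∗ Q = P) (hhi : Integrable h P) (hgi : Integrable g N) :
    ∃ κ : Kernel E E, IsMarkovKernel κ ∧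
      RDP.distortion P κ = ∫⁻ x, ‖x‖ₑ ^ 2 ∂N ∧
      RDP.mutualInfo P κ = ENNReal.ofReal (∫ x, h x ∂P - ∫ x, g x ∂N) := by
  obtain ⟨h1, h2, h3⟩ := prod_tilted_sub_eq_map (Q := Q) hg hh hP hN
  set J := (N.prod Q).map fun z ↦ (z.1 + z.2, z.2) with hJ
  have hm : Measurable fun z : E × E ↦ (z.1 + z.2, z.2) := by fun_prop
  have : IsProbabilityMeasure J := Measure.isProbabilityMeasure_map hm.aemeasurable
  have hfst : J.fst = P := by
    rw [Measure.fst, hJ, Measure.map_map measurable_fst hm, ← hPN]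
    rfl
  have hsnd : J.snd = Q := by
    rw [Measure.snd, hJ, Measure.map_map measurable_snd hm]
    exact Measure.snd_prod
  have hcomp : P ⊗ₘ J.condKernel = J := by rw [← hfst]; exact J.disintegrate _
  have hout : J.condKernel ∘ₘ P = Q := by rw [← Measure.snd_compProd, hcomp, hsnd]
  have hsub : J.map (fun z ↦ z.1 - z.2) = N := by
    rw [hJ, Measure.map_map (by fun_prop) hm]
    have : ((fun z : E × E ↦ z.1 - z.2) ∘ fun z : E × E ↦ (z.1 + z.2, z.2)) = Prod.fst := by
      ext z; simp
    rw [this]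
    exact Measure.fst_prod
  have hJh : Integrable (fun z : E × E ↦ h z.1) J := by
    rw [← hfst] at hhi
    exact hhi.comp_measurable measurable_fst
  have hJg : Integrable (fun z : E × E ↦ g (z.1 - z.2)) J := by
    rw [← hsub] at hgi
    exact hgi.comp_measurable (by fun_prop)
  refine ⟨J.condKernel, inferInstance, ?_, ?_⟩
  · rw [RDP.distortion, hcomp, ← hsub]
    exact (lintegral_map (f := fun x : E ↦ ‖x‖ₑ ^ 2) (by fun_prop)
      (measurable_fst.sub measurable_snd)).symm
  · rw [RDP.mutualInfo, hcomp, hout, ← h3, klDiv_tilted_left_self _ h1 h2 (by rw [h3]; exact hJh.sub hJg), h3,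
      integral_sub hJh hJg]
    congr 2
    · rw [← hfst, Measure.fst, integral_map (by fun_prop) hh.aestronglyMeasurable]
    · rw [← hsub, integral_map (by fun_prop) hg.aestronglyMeasurable]

end ShannonLowerBound

/-! ### Gaussian rate-distortion function at low distortion -/

section GaussianRateDistortion

variable {ι : Type*} [Fintype ι] [DecidableEq ι]

theorem multivariateGaussian_conv {A B : Matrix ι ι ℝ} (hA : A.PosSemidef) (hB : B.PosSemidef) :
    multivariateGaussian 0 A ∗ multivariateGaussian 0 B = multivariateGaussian 0 (A + B) := by
  refine Measure.ext_of_charFun (funext fun t ↦ ?_)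
  rw [charFun_conv, charFun_multivariateGaussian hA, charFun_multivariateGaussian hB,
    charFun_multivariateGaussian (hA.add hB), ← Complex.exp_add, Matrix.add_mulVec,
    dotProduct_add]
  congr 1
  push_cast
  simp
  ring

theorem gaussianPotential_smul_one {c : ℝ} (hc : 0 < c) (x : EuclideanSpace ℝ ι) :
    gaussianPotential (c • (1 : Matrix ι ι ℝ)) x =
      Fintype.card ι / 2 * Real.log (2 * Real.pi) + Fintype.card ι / 2 * Real.log c +
        ‖x‖ ^ 2 / (2 * c) := by
  have h : (c • (1 : Matrix ι ι ℝ))⁻¹ = c⁻¹ • (1 : Matrix ι ι ℝ) := by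
    refine Matrix.inv_eq_left_inv ?_
    simp [smul_smul, hc.ne']
  have hx : x.ofLp ⬝ᵥ x.ofLp = ‖x‖ ^ 2 := by
    rw [EuclideanSpace.real_norm_sq_eq]; simp [dotProduct, sq]
  rw [gaussianPotential, h, Matrix.smul_mulVec, Matrix.one_mulVec, dotProduct_smul, hx,
    Matrix.det_smul, Matrix.det_one, mul_one, Real.log_pow, smul_eq_mul]
  field_simp

theorem ofReal_le_mutualInfo_of_distortion_le {S : Matrix ι ι ℝ} (hS : S.PosDef) {c : ℝ}
    (hc : 0 < c) (κ : Kernel (EuclideanSpace ℝ ι) (EuclideanSpace ℝ ι)) [IsMarkovKernel κ]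
    (hκ : RDP.distortion (multivariateGaussian 0 S) κ ≤ ENNReal.ofReal (Fintype.card ι * c)) :
    ENNReal.ofReal (Real.log S.det / 2 - Fintype.card ι / 2 * Real.log c) ≤
      RDP.mutualInfo (multivariateGaussian 0 S) κ := by
  set P := multivariateGaussian (0 : EuclideanSpace ℝ ι) S with hP
  have hN : (c • (1 : Matrix ι ι ℝ)).PosDef := Matrix.PosDef.one.smul hc
  have hlin : ∫⁻ z, ENNReal.ofReal (‖z.1 - z.2‖ ^ 2) ∂(P ⊗ₘ κ) ≤
      ENNReal.ofReal (Fintype.card ι * c) := by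
    simp_rw [ENNReal.ofReal_pow (norm_nonneg _), ofReal_norm]
    exact hκ
  have hm : AEStronglyMeasurable
      (fun z : EuclideanSpace ℝ ι × EuclideanSpace ℝ ι ↦ ‖z.1 - z.2‖ ^ 2) (P ⊗ₘ κ) :=
    Measurable.aestronglyMeasurable (by fun_prop)
  have hsq : Integrable
      (fun z : EuclideanSpace ℝ ι × EuclideanSpace ℝ ι ↦ ‖z.1 - z.2‖ ^ 2) (P ⊗ₘ κ) :=
    (lintegral_ofReal_ne_top_iff_integrable hm (.of_forall fun _ ↦ by positivity)).1
      (hlin.trans_lt ENNReal.ofReal_lt_top).ne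
  have hle : ∫ z, ‖z.1 - z.2‖ ^ 2 ∂(P ⊗ₘ κ) ≤ Fintype.card ι * c := by
    rw [integral_eq_lintegral_of_nonneg_ae (.of_forall fun _ ↦ by positivity) hm]
    exact ENNReal.toReal_le_of_le_ofReal (by positivity) hlin
  obtain ⟨hi, hv⟩ := integral_gaussianPotential hS
  have hg : Integrable (fun z : EuclideanSpace ℝ ι × EuclideanSpace ℝ ι ↦
      gaussianPotential (c • (1 : Matrix ι ι ℝ)) (z.1 - z.2)) (P ⊗ₘ κ) := by
    simp_rw [gaussianPotential_smul_one hc]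
    exact (integrable_const _).add (hsq.div_const _)
  refine le_trans (ENNReal.ofReal_le_ofReal ?_) (ofReal_integral_le_mutualInfo
    (continuous_gaussianPotential _).measurable (continuous_gaussianPotential _).measurable
    (multivariateGaussian_zero_eq_withDensity hS) (multivariateGaussian_zero_eq_withDensity hN)
    hi κ hg)
  simp_rw [gaussianPotential_smul_one hc]
  rw [hv, integral_add (integrable_const _) (hsq.div_const _), integral_div]
  simp only [integral_const, probReal_univ, one_smul]
  -- This cancels the `Fintype.card ι / 2` in the entropy of the source; the `2π` terms cancel as
  -- well.
  have : (∫ z, ‖z.1 - z.2‖ ^ 2 ∂(P ⊗ₘ κ)) / (2 * c) ≤ Fintype.card ι / 2 := by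
    rw [div_le_iff₀ (by positivity)]
    linarith
  linarith

theorem exists_kernel_distortion_mutualInfo {S : Matrix ι ι ℝ} (hS : S.PosDef) {c : ℝ}
    (hc : 0 < c) (hSc : (S - c • (1 : Matrix ι ι ℝ)).PosSemidef) :
    ∃ κ : Kernel (EuclideanSpace ℝ ι) (EuclideanSpace ℝ ι), IsMarkovKernel κ ∧
      RDP.distortion (multivariateGaussian 0 S) κ = ENNReal.ofReal (Fintype.card ι * c) ∧
      RDP.mutualInfo (multivariateGaussian 0 S) κ =
        ENNReal.ofReal (Real.log S.det / 2 - Fintype.card ι / 2 * Real.log c) := by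
  have hN : (c • (1 : Matrix ι ι ℝ)).PosDef := Matrix.PosDef.one.smul hc
  obtain ⟨hi, hv⟩ := integral_gaussianPotential hS
  obtain ⟨hi', hv'⟩ := integral_gaussianPotential hN
  have hconv : multivariateGaussian (0 : EuclideanSpace ℝ ι) (c • (1 : Matrix ι ι ℝ)) ∗
      multivariateGaussian 0 (S - c • (1 : Matrix ι ι ℝ)) = multivariateGaussian 0 S := by
    rw [multivariateGaussian_conv hN.posSemidef hSc, add_sub_cancel]
  obtain ⟨κ, hκ, hd, hI⟩ := exists_kernel_mutualInfo_eq
    (continuous_gaussianPotential _).measurable (continuous_gaussianPotential _).measurable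
    (multivariateGaussian_zero_eq_withDensity hS) (multivariateGaussian_zero_eq_withDensity hN)
    hconv hi hi'
  refine ⟨κ, hκ, ?_, ?_⟩
  · rw [hd, lintegral_enorm_sq_multivariateGaussian hN.posSemidef]
    simp [mul_comm]
  · rw [hI, hv, hv', Matrix.det_smul, Matrix.det_one, mul_one, Real.log_pow]
    congr 1
    ring

/-- The Shannon lower bound is attained at low distortion. -/
theorem rdpFunction_multivariateGaussian_top
    (φ : RDP.PerceptionLoss (EuclideanSpace ℝ ι)) {S : Matrix ι ι ℝ} (hS : S.PosDef) {c : ℝ}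
    (hc : 0 < c) (hSc : (S - c • (1 : Matrix ι ι ℝ)).PosSemidef) :
    RDP.rdpFunction φ (multivariateGaussian 0 S) (ENNReal.ofReal (Fintype.card ι * c)) ∞ =
      ENNReal.ofReal (Real.log S.det / 2 - Fintype.card ι / 2 * Real.log c) := by
  refine le_antisymm ?_ (le_iInf₂ fun κ hκ ↦ ?_)
  · obtain ⟨κ, hκ, hd, hI⟩ := exists_kernel_distortion_mutualInfo hS hc hSc
    rw [← hI]
    exact iInf₂_le κ ⟨hκ, hd.le, le_top⟩
  · have := hκ.1
    exact ofReal_le_mutualInfo_of_distortion_le hS hc κ hκ.2.1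

end GaussianRateDistortion

/-! ### Reverse water-filling equation -/

section WaterFilling

variable {L : ℕ} {lam : Fin L → ℝ} {ε : ℝ}

theorem isWaterFillingLevel_iff_eq_div (hL : 0 < L) (hε : 0 < ε) (h : ∀ l, ε / L < lam l) (ν : ℝ) :
    RDP.IsWaterFillingLevel lam ε ν ↔ ν = ε / L := by
  have hL' : (0 : ℝ) < L := by exact_mod_cast hL
  have : Nonempty (Fin L) := ⟨⟨0, hL⟩⟩
  have hsum : ∑ l, (lam l - ε / L) = ∑ l, lam l - ε := by
    rw [Finset.sum_sub_distrib]
    simp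
    field_simp
  have hpos : 0 < ∑ l, (lam l - ε / L) :=
    Finset.sum_pos (fun l _ ↦ sub_pos.2 (h l)) Finset.univ_nonempty
  rw [RDP.IsWaterFillingLevel, ← hsum, max_eq_right hpos.le]
  constructor
  -- Moving `ν` off `ε / L` changes every summand strictly in the same direction. For larger `ν`
  -- this holds even for truncated summands, since each `lam l - ε / L` is positive.
  · intro heq
    rcases lt_trichotomy ν (ε / L) with hlt | rfl | hgt
    · refine absurd heq (ne_of_gt (Finset.sum_lt_sum_of_nonempty Finset.univ_nonempty fun l _ ↦ ?_))
      exact lt_max_of_lt_right (by linarith)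
    · rfl
    · refine absurd heq (ne_of_lt (Finset.sum_lt_sum_of_nonempty Finset.univ_nonempty fun l _ ↦ ?_))
      exact max_lt (sub_pos.2 (h l)) (by linarith)
  · rintro rfl
    exact Finset.sum_congr rfl fun l _ ↦ max_eq_right (sub_pos.2 (h l)).le

end WaterFilling

theorem proposition2 (L : ℕ) (hL : 0 < L)
    (S Θ : Matrix (Fin L) (Fin L) ℝ) (lam : Fin L → ℝ)
    (hS : S.PosDef)
    (hΘ : Θ ∈ Matrix.orthogonalGroup (Fin L) ℝ)
    (hdecomp : S = Θ.transpose * Matrix.diagonal lam * Θ)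
    (φ : RDP.PerceptionLoss (EuclideanSpace ℝ (Fin L)))
    (hφ : φ = RDP.klLoss (EuclideanSpace ℝ (Fin L)) ∨
      φ = RDP.wassersteinLoss (EuclideanSpace ℝ (Fin L))) :
    ∃ ε₀ : ℝ, 0 < ε₀ ∧ ∀ ε : ℝ, 0 < ε → ε < ε₀ →
      (RDP.rdpFunction φ (multivariateGaussian 0 S) (ENNReal.ofReal ε) ∞ ≠ ∞ ∧
        (RDP.rdpFunction φ (multivariateGaussian 0 S) (ENNReal.ofReal ε) ∞).toReal =
          (1 / 2) * ∑ l, Real.log ((L : ℝ) * lam l / ε)) ∧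
      (∃! ν : ℝ, RDP.IsWaterFillingLevel lam ε ν) ∧
      (∀ ν : ℝ, RDP.IsWaterFillingLevel lam ε ν →
        ∀ l : Fin L, RDP.waterLevel lam ν l = ε / (L : ℝ)) := by
  have hL' : (0 : ℝ) < L := by exact_mod_cast hL
  have : Nonempty (Fin L) := ⟨⟨0, hL⟩⟩
  have hΘΘ : Θ.transpose * Θ = 1 := by
    simpa [Matrix.star_eq_conjTranspose] using (Matrix.mem_orthogonalGroup_iff' _ _).1 hΘ
  have hu : IsUnit Θ := IsUnit.of_mul_eq_one_right _ hΘΘ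
  have hconj : S = star Θ * Matrix.diagonal lam * Θ := by
    rw [hdecomp, Matrix.star_eq_conjTranspose, Matrix.conjTranspose_eq_transpose_of_trivial]
  have hlam : ∀ l, 0 < lam l := by
    rw [hconj, Matrix.IsUnit.posDef_star_left_conjugate_iff hu, Matrix.posDef_diagonal_iff] at hS
    exact hS
  have hdet : S.det = ∏ l, lam l := by
    rw [hdecomp, Matrix.det_mul, Matrix.det_mul, mul_right_comm, ← Matrix.det_mul, hΘΘ,
      Matrix.det_one, one_mul, Matrix.det_diagonal]
  obtain ⟨l₀, hl₀⟩ := Finite.exists_min lam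
  -- Below `L` times the least eigenvalue, the common level `ε / L` stays under every eigenvalue.
  refine ⟨L * lam l₀, mul_pos hL' (hlam l₀), fun ε hε hε₀ ↦ ?_⟩
  have hlt (l : Fin L) : ε / L < lam l :=
    ((div_lt_iff₀' hL').2 hε₀).trans_le (hl₀ l)
  have hSc : (S - (ε / L) • (1 : Matrix (Fin L) (Fin L) ℝ)).PosSemidef := by
    have : S - (ε / L) • (1 : Matrix (Fin L) (Fin L) ℝ) =
        star Θ * Matrix.diagonal (fun l ↦ lam l - ε / L) * Θ := by
      have hd : Matrix.diagonal (fun l ↦ lam l - ε / L) =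
          Matrix.diagonal lam - (ε / L) • (1 : Matrix (Fin L) (Fin L) ℝ) := by
        rw [Matrix.smul_one_eq_diagonal, Matrix.diagonal_sub]
      have hs : star Θ * Θ = 1 := by
        rw [Matrix.star_eq_conjTranspose, Matrix.conjTranspose_eq_transpose_of_trivial, hΘΘ]
      rw [hd, mul_sub, sub_mul, ← hconj, mul_smul_comm, mul_one, smul_mul_assoc, hs]
    rw [this, Matrix.IsUnit.posSemidef_star_left_conjugate_iff hu, Matrix.posSemidef_diagonal_iff]
    exact fun l ↦ (sub_pos.2 (hlt l)).le
  have hrate := rdpFunction_multivariateGaussian_top φ hS (div_pos hε hL') hSc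
  have hval : Real.log S.det / 2 - Fintype.card (Fin L) / 2 * Real.log (ε / L) =
      1 / 2 * ∑ l, Real.log (L * lam l / ε) := by
    have hterm (l : Fin L) : Real.log (L * lam l / ε) = Real.log (lam l) - Real.log (ε / L) := by
      rw [← Real.log_div (hlam l).ne' (div_pos hε hL').ne']
      congr 1
      field_simp
    rw [hdet, Real.log_prod fun l _ ↦ (hlam l).ne']
    simp_rw [hterm]
    rw [Finset.sum_sub_distrib]
    simp
    ring
  -- Needed because `ENNReal.ofReal` truncates negative values to 0.
  have hnonneg : 0 ≤ 1 / 2 * ∑ l, Real.log (L * lam l / ε) := by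
    refine mul_nonneg (by norm_num) (Finset.sum_nonneg fun l _ ↦ Real.log_nonneg ?_)
    rw [one_le_div hε]
    exact ((div_lt_iff₀' hL').1 (hlt l)).le
  rw [hval, Fintype.card_fin, mul_div_cancel₀ _ hL'.ne'] at hrate
  have hwf := isWaterFillingLevel_iff_eq_div hL hε hlt
  refine ⟨⟨?_, ?_⟩, ⟨ε / L, (hwf _).2 rfl, fun ν hν ↦ (hwf ν).1 hν⟩, fun ν hν l ↦ ?_⟩
  · rw [hrate]
    exact ENNReal.ofReal_ne_top
  · rw [hrate, ENNReal.toReal_ofReal hnonneg]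
  · rw [(hwf ν).1 hν, RDP.waterLevel, if_neg (hlt l).not_ge]
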